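/- Proposition 6.4. Let $n\ge 0$, write points of $\mathbb R^n\times\mathbb R$ as $(x,t)$, and let $\pi: PT^*(\mathbb R^n\times\mathbb R)\to\mathbb R^n\times\mathbb R$ be the projective cotangent bundle, $PT^*(\mathbb R^n\times\mathbb R)\cong(\mathbb R^n\times\mathbb R)\times P((\mathbb R^n\times\mathbb R)^*)$, with its canonical contact structure $K$: for $p=(z,[\alpha])$, $K_p$ is the set of $w\in T_pPT^*(\mathbb R^n\times\mathbb R)$ with $\alpha(d\pi\, w)=0$. A big Legendrian submanifold is a smooth ($C^\infty$) $n$-dimensional submanifold $L\subset PT^*(\mathbb R^n\times\mathbb R)$ with $T_pL\subset K_p$ for every $p\in L$; its big wave front is $W(L)=\pi(L)$; the regular set of $\pi|_L$ is the set of $p\in L$ at which $d(\pi|_L)_p$ has rank $n$. Let $(L,p_0)$ and $(L',p_0')$ be germs of big Legendrian submanifolds such that the regular set of $\pi|_L$ is dense in $L$ near $p_0$, and the regular set of $\pi|_{L'}$ is dense in $L'$ near $p_0'$. Call a $C^\infty$ diffeomorphism germ $\Phi:(\mathbb R^n\times\mathbb R,\pi(p_0))\to(\mathbb R^n\times\mathbb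 R,\pi(p_0'))$ space-parametrized if it has the form $\Phi(x,t)=(\phi_1(x),\phi_2(x,t))$. Then the following are equivalent. (i) The germs are $s$-$P$-Legendrian equivalent: there is a space-parametrized diffeomorphism germ $\Phi$ whose contact lift $\widehat\Phi(z,[\alpha])=(\Phi(z),[\alpha\circ(d\Phi_z)^{-1}])$ satisfies $\widehat\Phi(p_0)=p_0'$ and $\widehat\Phi(L)=L'$ as set germs at $p_0'$. (ii) The big wave front germs $(W(L),\pi(p_0))$ and $(W(L'),\pi(p_0'))$ are $s$-$P$-diffeomorphic: there is a space-parametrized diffeomorphism germ $\Phi$ with $\Phi(W(L))=W(L')$ as germs at $\pi(p_0')$. Here the equality of front germs in (ii) is understood for arbitrarily small representatives of the Legendrian germs: for all neighbourhoods $V$ of $p_0$ and $V'$ of $p_0'$ there are neighbourhoods $U\subset V$ of $p_0$ and $U'\subset V'$ of $p_0'$ such that $\Phi(\pi(L\cap U))$ and $\pi(L'\cap U')$ have the same set germ at $\pi(p_0')$. When the set germs of $\pi(L\cap U)$ at $\pi(p_0)$ and of $\pi(L'\cap U')$ at $\pi(p_0')$ do not depend on the sufficiently small neighbourhoods $U,U'$,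 this is the equality of these two set germs. -/

import Mathlib

open scoped Topology ContDiff

/-- The quotient topology on a projective space. -/
noncomputable instance BigFront.projectivizationTopology (V : Type*) [NormedAddCommGroup V] [NormedSpace ℝ V] :
    TopologicalSpace (Projectivization ℝ V) :=
  TopologicalSpace.coinduced (Projectivization.mk' ℝ) inferInstance

namespace BigFront

/-- Space-time `ℝⁿ × ℝ`, with points `(x, t)`. -/
abbrev SpaceTime (n : ℕ) : Type := EuclideanSpace ℝ (Fin n) × ℝ

/-- Covectors on `ℝⁿ × ℝ`. -/
abbrev Covector (n : ℕ) : Type := SpaceTime n →L[ℝ] ℝ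

/-- The projective cotangent bundle `PT*(ℝⁿ × ℝ)` in its trivialization
`(ℝⁿ × ℝ) × P((ℝⁿ × ℝ)*)`. A point is a pair `(z, [ξ])`, and the bundle projection `π` is
`Prod.fst`. -/
abbrev PT (n : ℕ) : Type := SpaceTime n × Projectivization ℝ (Covector n)

/-- The map `u ↦ (γ u, [ξ u])` into `PT*(ℝⁿ × ℝ)` with homogeneous coordinates `ξ`. -/
noncomputable def toPT {n : ℕ} (γ : EuclideanSpace ℝ (Fin n) → SpaceTime n)
    (ξ : EuclideanSpace ℝ (Fin n) → {α : Covector n // α ≠ 0}) :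
    EuclideanSpace ℝ (Fin n) → PT n :=
  fun u => (γ u, Projectivization.mk' ℝ (ξ u))

/-- `u ↦ (γ u, [ξ u])`, `u ∈ O ⊆ ℝⁿ`, is a smooth local parametrization around `p`, with parameter
value `u₀` at `p`, of the `n`-dimensional submanifold `L` of `PT*(ℝⁿ × ℝ)`. A map into projective
space is smooth iff it has, locally, smooth nowhere vanishing homogeneous coordinates. -/
structure IsLocalParam {n : ℕ} (L : Set (PT n)) (p : PT n) (O : Set (EuclideanSpace ℝ (Fin n)))
    (u₀ : EuclideanSpace ℝ (Fin n)) (γ : EuclideanSpace ℝ (Fin n) → SpaceTime n)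
    (ξ : EuclideanSpace ℝ (Fin n) → {α : Covector n // α ≠ 0}) : Prop where
  isOpen : IsOpen O
  mem : u₀ ∈ O
  map_eq : toPT γ ξ u₀ = p
  smooth_base : ContDiffOn ℝ ∞ γ O
  smooth_covector : ContDiffOn ℝ ∞ (fun u => (ξ u : Covector n)) O
  /-- `toPT γ ξ` is an immersion: the kernel of the differential of `α ↦ [α]` at `α` is the
  line spanned by `α`. -/
  immersion : ∀ u ∈ O, ∀ v, fderiv ℝ γ u v = 0 →
    (∃ c : ℝ, fderiv ℝ (fun u => (ξ u : Covector n)) u v = c • (ξ u : Covector n)) → v = 0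
  /-- `toPT γ ξ` is a homeomorphism of `O` onto its image. -/
  embedding : Topology.IsEmbedding (O.domRestrict (toPT γ ξ))
  /-- The image of `O` is a relatively open subset of `L`. -/
  image_eq : ∃ V : Set (PT n), IsOpen V ∧ toPT γ ξ '' O = L ∩ V

/-- `L` is a big Legendrian submanifold of `PT*(ℝⁿ × ℝ)`: a smooth `n`-dimensional submanifold
tangent to the canonical contact structure, whose hyperplane at `p = (z, [α])` is
`K_p = {w ∈ T_p PT* | α (dπ w) = 0}`. -/
def IsBigLegendrian {n : ℕ} (L : Set (PT n)) : Prop :=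
  ∀ p ∈ L, ∃ O u₀ γ ξ, IsLocalParam L p O u₀ γ ξ ∧
    ∀ u ∈ O, ∀ v, (ξ u : Covector n) (fderiv ℝ γ u v) = 0

/-- The regular set of the Legendrian map `π|_L`: the points `p` where `d(π|_L)_p` has rank
`n = dim L`, i.e. is injective. -/
def regularSet {n : ℕ} (L : Set (PT n)) : Set (PT n) :=
  {p | p ∈ L ∧ ∃ O u₀ γ ξ, IsLocalParam L p O u₀ γ ξ ∧ Function.Injective (fderiv ℝ γ u₀)}

/-- The regular set of `π|_L` is dense in the germ `(L, p₀)`. -/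
def RegularDenseAt {n : ℕ} (L : Set (PT n)) (p₀ : PT n) : Prop :=
  ∃ U ∈ 𝓝 p₀, L ∩ U ⊆ closure (regularSet L)

/-- `A` and `B` have the same set germ at `a`. -/
def SameGerm {X : Type*} [TopologicalSpace X] (a : X) (A B : Set X) : Prop :=
  ∀ᶠ z in 𝓝 a, z ∈ A ↔ z ∈ B

/-- `Φ` represents a diffeomorphism germ `(ℝⁿ × ℝ, q) → (ℝⁿ × ℝ, q')` of the space-parametrized
form `Φ (x, t) = (φ₁ x, φ₂ (x, t))`. -/
structure IsSPDiffeoGerm {n : ℕ} (Φ : OpenPartialHomeomorph (SpaceTime n) (SpaceTime n))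
    (q q' : SpaceTime n) : Prop where
  mem_source : q ∈ Φ.source
  map_eq : Φ q = q'
  contDiffOn : ContDiffOn ℝ ∞ Φ Φ.source
  contDiffOn_symm : ContDiffOn ℝ ∞ Φ.symm Φ.target
  spaceParametrized : ∃ (φ₁ : EuclideanSpace ℝ (Fin n) → EuclideanSpace ℝ (Fin n))
    (φ₂ : EuclideanSpace ℝ (Fin n) × ℝ → ℝ),
    ∀ x t, (x, t) ∈ Φ.source → Φ (x, t) = (φ₁ x, φ₂ (x, t))

open Classical in
/-- The contact lift of a diffeomorphism `Φ` between open subsets of `ℝⁿ × ℝ`, over `Φ.source`: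
`(z, [α]) ↦ (Φ z, [α ∘ (dΦ_z)⁻¹])`. See `contactLift_mk`; the `else` branch is never used
over `Φ.source`. -/
noncomputable def contactLift {n : ℕ} (Φ : OpenPartialHomeomorph (SpaceTime n) (SpaceTime n))
    (p : PT n) : PT n :=
  if h : p.2.rep.comp (fderiv ℝ Φ.symm (Φ p.1)) ≠ 0 then
    (Φ p.1, Projectivization.mk ℝ (p.2.rep.comp (fderiv ℝ Φ.symm (Φ p.1))) h)
  else p

lemma fderiv_symm_comp_fderiv {n : ℕ} {Φ : OpenPartialHomeomorph (SpaceTime n) (SpaceTime n)}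
    {q q' : SpaceTime n} (hΦ : IsSPDiffeoGerm Φ q q') {z : SpaceTime n} (hz : z ∈ Φ.source) :
    (fderiv ℝ Φ.symm (Φ z)).comp (fderiv ℝ Φ z) = ContinuousLinearMap.id ℝ (SpaceTime n) := by
  have h1 : DifferentiableAt ℝ Φ z :=
    (hΦ.contDiffOn.contDiffAt (Φ.open_source.mem_nhds hz)).differentiableAt (by simp)
  have h2 : DifferentiableAt ℝ Φ.symm (Φ z) :=
    (hΦ.contDiffOn_symm.contDiffAt (Φ.open_target.mem_nhds (Φ.map_source hz))).differentiableAt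
      (by simp)
  rw [← fderiv_comp z h2 h1]
  have : (Φ.symm ∘ Φ) =ᶠ[𝓝 z] id := by
    filter_upwards [Φ.open_source.mem_nhds hz] with w hw using Φ.left_inv hw
  rw [this.fderiv_eq, fderiv_id]

lemma comp_fderiv_symm_ne_zero {n : ℕ}
    {Φ : OpenPartialHomeomorph (SpaceTime n) (SpaceTime n)} {q q' : SpaceTime n}
    (hΦ : IsSPDiffeoGerm Φ q q') {z : SpaceTime n} (hz : z ∈ Φ.source) {α : Covector n}
    (hα : α ≠ 0) : α.comp (fderiv ℝ Φ.symm (Φ z)) ≠ 0 := by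
  intro h
  apply hα
  have h' := congrArg (fun β : Covector n => β.comp (fderiv ℝ Φ z)) h
  simpa [ContinuousLinearMap.comp_assoc, fderiv_symm_comp_fderiv hΦ hz] using h'

/-- The contact lift does not depend on the representative of the covector direction. -/
lemma contactLift_mk {n : ℕ} {Φ : OpenPartialHomeomorph (SpaceTime n) (SpaceTime n)}
    {q q' : SpaceTime n} (hΦ : IsSPDiffeoGerm Φ q q') {z : SpaceTime n} (hz : z ∈ Φ.source)
    {α : Covector n} (hα : α ≠ 0) :
    contactLift Φ (z, Projectivization.mk ℝ α hα) =
      (Φ z, Projectivization.mk ℝ (α.comp (fderiv ℝ Φ.symm (Φ z)))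
        (comp_fderiv_symm_ne_zero hΦ hz hα)) := by
  have h := comp_fderiv_symm_ne_zero hΦ hz (Projectivization.mk ℝ α hα).rep_nonzero
  rw [contactLift, dif_pos h]
  obtain ⟨a, ha⟩ := Projectivization.exists_smul_eq_mk_rep ℝ α hα
  refine Prod.ext rfl ((Projectivization.mk_eq_mk_iff ℝ _ _ _ _).2 ⟨a, ?_⟩)
  simp only [← ha]
  ext <;> simp

/-- Space-parametrized Legendrian equivalence of the germs `(L, p₀)` and `(L', p₀')`: the contact
lift `Φ̂` of a diffeomorphism germ `Φ` of the space-parametrized form satisfies `Φ̂ p₀ = p₀'` and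
`Φ̂ L = L'` as set germs at `p₀'`. -/
def SPLegendrianEquivalent {n : ℕ} (L : Set (PT n)) (p₀ : PT n) (L' : Set (PT n)) (p₀' : PT n) :
    Prop :=
  ∃ Φ : OpenPartialHomeomorph (SpaceTime n) (SpaceTime n), IsSPDiffeoGerm Φ p₀.1 p₀'.1 ∧
    contactLift Φ p₀ = p₀' ∧
    SameGerm p₀' (contactLift Φ '' (L ∩ {p | p.1 ∈ Φ.source})) L'

/-- The big wave front `W(L) = π(L)`. -/
def bigWaveFront {n : ℕ} (L : Set (PT n)) : Set (SpaceTime n) := Prod.fst '' L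

/-- The big wave front germs of `(L, p₀)` and `(L', p₀')` are space-parametrized diffeomorphic:
there is a diffeomorphism germ `Φ` of the space-parametrized form such that `Φ (W(L)) = W(L')` as
set germs at `π(p₀')`.

Here `L` and `L'` stand for germs, so they may be replaced by arbitrarily small representatives
`L ∩ U` and `L' ∩ U'`; the equality is required for arbitrarily small representatives. If the set
germ of `W(L ∩ U)` at `π(p₀)` is the same for all small neighbourhoods `U` of `p₀` (as it is when
`p₀` is isolated in its fibre), and likewise for `L'`, this is equality of these two set germs. -/
def FrontsSPDiffeomorphic {n : ℕ} (L : Set (PT n)) (p₀ : PT n) (L' : Set (PT n)) (p₀' : PT n) :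
    Prop :=
  ∃ Φ : OpenPartialHomeomorph (SpaceTime n) (SpaceTime n), IsSPDiffeoGerm Φ p₀.1 p₀'.1 ∧
    ∀ V ∈ 𝓝 p₀, ∀ V' ∈ 𝓝 p₀', ∃ U ∈ 𝓝 p₀, ∃ U' ∈ 𝓝 p₀', U ⊆ V ∧ U' ⊆ V' ∧
      SameGerm p₀'.1 (Φ '' (bigWaveFront (L ∩ U) ∩ Φ.source)) (bigWaveFront (L' ∩ U'))

end BigFront

/-! A Legendrian lift is determined by its front wherever the front is immersed: at a regular point
the covector direction is the annihilator of the tangent hyperplane. The contact lift of `Φ`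
therefore carries `L` to `L'` as soon as the tangent hyperplanes of `Φ(W(L))` and `W(L')` agree at
enough common points.

Equality of the fronts as sets does not give this at every common point, since `W(L')` may have
several sheets or singularities there. `ae_range_fderiv_eq` gives it at almost every point: where
two maps of the same dimension meet and the first is an immersion, tangency fails only over a null
set of parameters, by a Sard argument. Sets of full measure are dense and regular points are dense
in `L`, so by continuity the lift sends `L` near `p₀` into the closure of `L' ∩ V'` for every
neighbourhood `V'` of `p₀'`. Since submanifolds are locally closed and `PT n` is Hausdorff, the lift
sends `p₀` to `p₀'` and the germ of `L` into that of `L'`. The same argument for `Φ.symm` gives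
equality. The converse is projection of the lift, with neighbourhoods chosen to correspond. -/

open MeasureTheory Set Filter

/-! ### Tangency of two parametrized sets at almost every common point -/

section GeneralPosition

variable {E F : Type*} [NormedAddCommGroup E] [NormedSpace ℝ E] [FiniteDimensional ℝ E]
  [NormedAddCommGroup F] [NormedSpace ℝ F] [FiniteDimensional ℝ F]

/-- The derivative of a map vanishes at almost every zero of the map. -/
lemma ae_fderiv_eq_zero_of_eq_zero [MeasurableSpace E] [BorelSpace E] (μ : Measure E)
    [μ.IsAddHaarMeasure] {G : E → F} {Ω : Set E} (hΩ : IsOpen Ω) (hG : DifferentiableOn ℝ G Ω) :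
    ∀ᵐ u ∂μ, u ∈ Ω → G u = 0 → fderiv ℝ G u = 0 := by
  rcases subsingleton_or_nontrivial E with hE | hE
  · exact ae_of_all _ fun u _ _ => Subsingleton.elim _ _
  obtain ⟨v, hv⟩ := exists_ne (0 : E)
  set S : Set E := Ω ∩ G ⁻¹' {0} with hS
  have hSm : MeasurableSet S := by
    obtain ⟨C, hC, hC'⟩ := (continuousOn_iff_isClosed.1 hG.continuousOn) {0} isClosed_singleton
    rw [hS, inter_comm, hC']
    exact hC.measurableSet.inter hΩ.measurableSet
  have hd : ∀ u ∈ S, HasFDerivAt G (fderiv ℝ G u) u := fun u hu =>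
    (hG.differentiableAt (hΩ.mem_nhds hu.1)).hasFDerivAt
  let b := Module.finBasis ℝ F
  have key : ∀ i, ∀ᵐ u ∂μ, u ∈ S →
      -- Each coordinate of `G`, times a fixed `v ≠ 0`, is a map `E → E` vanishing on `S`. It is
      -- approximated there by the zero map with constant `0`, so its derivative vanishes at almost
      -- every point of `S`.
      (((b.coord i).toContinuousLinearMap.comp (fderiv ℝ G u)).smulRight v : E →L[ℝ] E) = 0 := by
    intro i
    have happ : ApproximatesLinearOn (fun u => ((b.coord i).toContinuousLinearMap (G u)) • v)
        (0 : E →L[ℝ] E) S 0 := by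
      intro x hx y hy
      have hx' : G x = 0 := hx.2
      have hy' : G y = 0 := hy.2
      simp [hx', hy']
    have := happ.norm_fderiv_sub_le μ hSm
      (fun u => ((b.coord i).toContinuousLinearMap.comp (fderiv ℝ G u)).smulRight v)
      (fun u hu => (((b.coord i).toContinuousLinearMap.hasFDerivAt.comp u
        (hd u hu)).smul_const v).hasFDerivWithinAt)
    rw [ae_restrict_iff' hSm] at this
    filter_upwards [this] with u hu huS
    simpa only [sub_zero, nonpos_iff_eq_zero, nnnorm_eq_zero] using hu huS
  filter_upwards [ae_all_iff.2 key] with u hu huΩ hu0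
  ext w
  refine b.ext_elem fun i => ?_
  have := congrArg (fun A : E →L[ℝ] E => A w) (hu i ⟨huΩ, hu0⟩)
  simpa [hv] using this

/-- An immersion has, locally, a differentiable left inverse. -/
lemma exists_local_leftInverse {γ : E → F} {u₀ : E} (hγ : ContDiffAt ℝ 1 γ u₀)
    (hinj : Function.Injective (fderiv ℝ γ u₀)) :
    ∃ (B : Set E) (D : Set F) (r : F → E), IsOpen B ∧ u₀ ∈ B ∧ IsOpen D ∧
      DifferentiableOn ℝ γ B ∧ DifferentiableOn ℝ r D ∧ MapsTo γ B D ∧ LeftInvOn r γ B := by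
  -- Composing `γ` with a linear left inverse of its derivative gives a map with derivative the
  -- identity at `u₀`; the inverse function theorem applies to it.
  obtain ⟨A, hA⟩ := (fderiv ℝ γ u₀).toLinearMap.exists_leftInverse_of_injective
    (LinearMap.ker_eq_bot.2 hinj)
  let a : F →L[ℝ] E := A.toContinuousLinearMap
  have ha : a.comp (fderiv ℝ γ u₀) = (ContinuousLinearEquiv.refl ℝ E : E →L[ℝ] E) := by
    ext v
    exact LinearMap.congr_fun hA v
  have hf : ContDiffAt ℝ 1 (a ∘ γ) u₀ := a.contDiff.contDiffAt.comp u₀ hγ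
  have hf' : HasFDerivAt (a ∘ γ) ((ContinuousLinearEquiv.refl ℝ E : E ≃L[ℝ] E) : E →L[ℝ] E) u₀ := by
    rw [← ha]
    exact a.hasFDerivAt.comp u₀ (hγ.differentiableAt (by simp)).hasFDerivAt
  let e := hf.toOpenPartialHomeomorph (a ∘ γ) hf' (by simp)
  have he : ∀ u, e u = a (γ u) := fun u => rfl
  have hu₀ : u₀ ∈ e.source := hf.mem_toOpenPartialHomeomorph_source hf' (by simp)
  have hr : ContDiffAt ℝ 1 e.symm (e u₀) := hf.to_localInverse hf' (by simp)
  obtain ⟨T, hT, hTo, hTu⟩ := eventually_nhds_iff.1 (hr.eventually (by simp))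
  obtain ⟨B, hB, hBo, hBu⟩ := eventually_nhds_iff.1 (hγ.eventually (by simp))
  have hB' : IsOpen (B ∩ (e.source ∩ e ⁻¹' T)) :=
    hBo.inter (e.continuousOn.isOpen_inter_preimage e.open_source hTo)
  refine ⟨B ∩ (e.source ∩ e ⁻¹' T), a ⁻¹' T, e.symm ∘ a, hB', ⟨hBu, hu₀, hTu⟩,
    hTo.preimage a.continuous, ?_, ?_, ?_, ?_⟩
  · exact fun u hu => ((hB u hu.1).differentiableAt (by simp)).differentiableWithinAt
  · intro z hz
    exact (((hT (a z) hz).differentiableAt (by simp)).comp z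
      a.differentiableAt).differentiableWithinAt
  · exact fun u hu => hu.2.2
  · exact fun u hu => e.left_inv hu.2.1

/-- Near an immersive point of `γ`, for almost every parameter `u`, every parameter `u'` of a
second map `γ'` of the same dimension with `γ' u' = γ u` gives the same tangent space. -/
lemma ae_range_fderiv_eq [MeasurableSpace E] [BorelSpace E] (μ : Measure E)
    [μ.IsAddHaarMeasure] {γ γ' : E → F} {u₀ : E} {O : Set E} (hγ : ContDiffAt ℝ 1 γ u₀)
    (hinj : Function.Injective (fderiv ℝ γ u₀)) (hO : IsOpen O) (hγ' : DifferentiableOn ℝ γ' O) :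
    ∃ B ∈ 𝓝 u₀, ∀ᵐ u ∂μ, u ∈ B → Function.Injective (fderiv ℝ γ u) ∧
      ∀ u' ∈ O, γ' u' = γ u → range (fderiv ℝ γ' u') = range (fderiv ℝ γ u) := by
  obtain ⟨B, D, r, hBo, hu₀, hDo, hγB, hrD, hmaps, hleft⟩ := exists_local_leftInverse hγ hinj
  set Ω₁ : Set E := O ∩ γ' ⁻¹' D with hΩ₁
  have hΩ₁o : IsOpen Ω₁ := hγ'.continuousOn.isOpen_inter_preimage hO hDo
  have hτ₁ : DifferentiableOn ℝ (r ∘ γ') Ω₁ :=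
    hrD.comp (hγ'.mono inter_subset_left) fun u hu => hu.2
  set Ω : Set E := Ω₁ ∩ (r ∘ γ') ⁻¹' B with hΩ
  have hΩo : IsOpen Ω := hτ₁.continuousOn.isOpen_inter_preimage hΩ₁o hBo
  have hτ : DifferentiableOn ℝ (r ∘ γ') Ω := hτ₁.mono inter_subset_left
  have hγ'Ω : DifferentiableOn ℝ γ' Ω := hγ'.mono fun u hu => hu.1.1
  have hγτ : DifferentiableOn ℝ (γ ∘ (r ∘ γ')) Ω := hγB.comp hτ fun u hu => hu.2
  -- With `τ = r ∘ γ'`, a coincidence `γ' u' = γ u` forces `τ u' = u` and makes `γ' - γ ∘ τ` vanish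
  -- at `u'`. The bad `u` are the `τ`-images of the null set of zeros with nonzero derivative, and
  -- the critical values of `τ`. Both sets are null, and avoiding them handles all `u'` at once.
  have hG := hγ'Ω.sub hγτ
  have hnull₁ := (ae_iff.1 (ae_fderiv_eq_zero_of_eq_zero μ hΩo hG))
  have himg₁ := addHaar_image_eq_zero_of_differentiableOn_of_addHaar_eq_zero μ
    (s := {u | ¬(u ∈ Ω → (γ' - γ ∘ (r ∘ γ')) u = 0 → fderiv ℝ (γ' - γ ∘ (r ∘ γ')) u = 0)})
    (hτ.mono fun u hu => by
      simp only [mem_ofPred_eq, Classical.not_imp] at hu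
      exact hu.1) hnull₁
  have himg₂ := addHaar_image_eq_zero_of_det_fderivWithin_eq_zero μ
    (s := {u | u ∈ Ω ∧ (fderiv ℝ (r ∘ γ') u).det = 0}) (f := r ∘ γ') (f' := fderiv ℝ (r ∘ γ'))
    (fun u hu => (hτ.differentiableAt (hΩo.mem_nhds hu.1)).hasFDerivAt.hasFDerivWithinAt)
    (fun u hu => hu.2)
  refine ⟨B, hBo.mem_nhds hu₀, ?_⟩
  filter_upwards [measure_eq_zero_iff_ae_notMem.1 himg₁, measure_eq_zero_iff_ae_notMem.1 himg₂]
    with u h₁ h₂ huB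
  have hγu := (hγB.differentiableAt (hBo.mem_nhds huB))
  refine ⟨?_, fun u' hu' heq => ?_⟩
  · have hcomp : (fderiv ℝ r (γ u)).comp (fderiv ℝ γ u) = ContinuousLinearMap.id ℝ E := by
      rw [← fderiv_comp u (hrD.differentiableAt (hDo.mem_nhds (hmaps huB))) hγu]
      have : r ∘ γ =ᶠ[𝓝 u] id := by
        filter_upwards [hBo.mem_nhds huB] with w hw using hleft hw
      rw [this.fderiv_eq, fderiv_id]
    exact Function.LeftInverse.injective fun v =>
      congrArg (fun A : E →L[ℝ] E => A v) hcomp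
  · have hτu' : (r ∘ γ') u' = u := by
      rw [Function.comp_apply, heq, hleft huB]
    have hu'Ω : u' ∈ Ω := ⟨⟨hu', by rw [mem_preimage, heq]; exact hmaps huB⟩, by
      rw [mem_preimage, hτu']; exact huB⟩
    have hdet : (fderiv ℝ (r ∘ γ') u').det ≠ 0 := fun h => h₂ ⟨u', ⟨hu'Ω, h⟩, hτu'⟩
    have hG0 : fderiv ℝ (γ' - γ ∘ (r ∘ γ')) u' = 0 := by
      by_contra h
      refine h₁ ⟨u', ?_, hτu'⟩
      simp only [mem_ofPred_eq, Classical.not_imp]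
      exact ⟨hu'Ω, by rw [Pi.sub_apply, Function.comp_apply, hτu', heq, sub_self], h⟩
    have hnhds := hΩo.mem_nhds hu'Ω
    rw [fderiv_sub (hγ'Ω.differentiableAt hnhds) (hγτ.differentiableAt hnhds), sub_eq_zero,
      fderiv_comp u' (by rw [hτu']; exact hγu) (hτ.differentiableAt hnhds), hτu'] at hG0
    have hsurj : Function.Surjective (fderiv ℝ (r ∘ γ') u') :=
      ((fderiv ℝ (r ∘ γ') u').toContinuousLinearEquivOfDetNeZero hdet).surjective
    rw [hG0, ContinuousLinearMap.coe_comp, hsurj.range_comp]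

end GeneralPosition

/-- Two nonzero covectors with a common kernel of codimension one are proportional. -/
lemma exists_units_smul_eq_of_range_le_ker {E F : Type*} [NormedAddCommGroup E] [NormedSpace ℝ E]
    [FiniteDimensional ℝ E] [NormedAddCommGroup F] [NormedSpace ℝ F] [FiniteDimensional ℝ F]
    (hdim : Module.finrank ℝ F = Module.finrank ℝ E + 1) {A : E →L[ℝ] F}
    (hA : Function.Injective A) {α β : F →L[ℝ] ℝ} (hα : α ≠ 0) (hβ : β ≠ 0)
    (hαA : ∀ v, α (A v) = 0) (hβA : ∀ v, β (A v) = 0) : ∃ c : ℝˣ, c • β = α := by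
  have hker : ∀ x, β x = 0 → α x = 0 := by
    obtain ⟨y, hy⟩ : ∃ y, β y ≠ 0 := by
      by_contra! h
      exact hβ (ContinuousLinearMap.ext h)
    have hrange : Module.finrank ℝ (LinearMap.range A.toLinearMap) = Module.finrank ℝ E :=
      LinearMap.finrank_range_of_inj hA
    have hle : LinearMap.range A.toLinearMap ≤ LinearMap.ker β.toLinearMap := by
      rintro _ ⟨v, rfl⟩
      exact hβA v
    have hlt : Module.finrank ℝ (LinearMap.ker β.toLinearMap) < Module.finrank ℝ F := by
      refine Submodule.finrank_lt fun h => hy ?_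
      have : y ∈ LinearMap.ker β.toLinearMap := h ▸ Submodule.mem_top
      exact this
    -- The proper subspace `ker β` contains the hyperplane `range A`, so they coincide.
    have heq := Submodule.eq_of_le_of_finrank_le hle (by omega)
    intro x hx
    have : x ∈ LinearMap.range A.toLinearMap := heq ▸ (show x ∈ LinearMap.ker β.toLinearMap from hx)
    obtain ⟨v, rfl⟩ := this
    exact hαA v
  obtain ⟨y, hy⟩ : ∃ y, β y ≠ 0 := by
    by_contra! h
    exact hβ (ContinuousLinearMap.ext h)
  have hprop : ∀ x, α x = α y / β y * β x := by
    intro x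
    have := hker (β y • x - β x • y) (by simp [mul_comm])
    simp only [map_sub, map_smul, smul_eq_mul] at this
    field_simp
    linarith
  have hc : α y / β y ≠ 0 := by
    intro h
    exact hα (ContinuousLinearMap.ext fun x => by simp [hprop x, h])
  exact ⟨Units.mk0 _ hc, ContinuousLinearMap.ext fun x => (hprop x).symm⟩

namespace BigFront

/-! ### Topology of the projective space of covectors -/

section Projectivization

variable {V : Type*} [NormedAddCommGroup V] [NormedSpace ℝ V]

lemma mk'_eq_mk'_iff (v w : {v : V // v ≠ 0}) :
    Projectivization.mk' ℝ v = Projectivization.mk' ℝ w ↔ ∃ a : ℝˣ, a • (w : V) = v :=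
  Projectivization.mk_eq_mk_iff ℝ _ _ v.2 w.2

/-- The saturation of an open set is the union of its multiples by nonzero scalars. Openness keeps
the quotient property under products, which continuity on `PT n` relies on. -/
lemma isOpenQuotientMap_mk' :
    IsOpenQuotientMap (Projectivization.mk' ℝ : {v : V // v ≠ 0} → Projectivization ℝ V) := by
  have hq : Topology.IsQuotientMap
      (Projectivization.mk' ℝ : {v : V // v ≠ 0} → Projectivization ℝ V) :=
    ⟨⟨rfl⟩, Quotient.mk''_surjective⟩
  refine ⟨hq.surjective, hq.continuous, fun s hs => ?_⟩
  rw [← hq.isOpen_preimage]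
  have hunion : Projectivization.mk' ℝ ⁻¹' (Projectivization.mk' ℝ '' s) =
      ⋃ a : ℝˣ, (fun v : {v : V // v ≠ 0} =>
        (⟨a • (v : V), (smul_ne_zero_iff_ne a).2 v.2⟩ : {v : V // v ≠ 0})) ⁻¹' s := by
    ext v
    simp only [mem_preimage, mem_image, mem_iUnion]
    constructor
    · rintro ⟨w, hw, hwv⟩
      obtain ⟨a, ha⟩ := (mk'_eq_mk'_iff w v).1 hwv
      exact ⟨a, by convert hw⟩
    · rintro ⟨a, ha⟩
      exact ⟨_, ha, (mk'_eq_mk'_iff _ v).2 ⟨a, rfl⟩⟩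
  rw [hunion]
  exact isOpen_iUnion fun a =>
    hs.preimage ((continuous_subtype_val.const_smul (a : ℝ)).subtype_mk _)

/-- Proportionality of nonzero covectors is cut out by the closed conditions `α x * β y = α y * β
x`, and an open quotient by a closed relation is Hausdorff. -/
instance projectivization_dual_t2Space : T2Space (Projectivization ℝ (V →L[ℝ] ℝ)) := by
  rw [t2Space_iff_of_isOpenQuotientMap isOpenQuotientMap_mk']
  have hset : {q : {α : V →L[ℝ] ℝ // α ≠ 0} × {α : V →L[ℝ] ℝ // α ≠ 0} |
      Projectivization.mk' ℝ q.1 = Projectivization.mk' ℝ q.2} =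
      ⋂ (x : V) (y : V), {q | (q.1 : V →L[ℝ] ℝ) x * (q.2 : V →L[ℝ] ℝ) y =
        (q.1 : V →L[ℝ] ℝ) y * (q.2 : V →L[ℝ] ℝ) x} := by
    ext ⟨α, β⟩
    simp only [mem_ofPred_eq, mem_iInter, mk'_eq_mk'_iff]
    constructor
    · rintro ⟨a, ha⟩ x y
      simp only [← ha, _root_.smul_apply, Units.smul_def, smul_eq_mul]
      ring
    · intro h
      obtain ⟨y, hy⟩ : ∃ y, (β : V →L[ℝ] ℝ) y ≠ 0 := by
        by_contra! h
        exact β.2 (ContinuousLinearMap.ext h)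
      have hprop : ∀ x, (α : V →L[ℝ] ℝ) x =
          (α : V →L[ℝ] ℝ) y / (β : V →L[ℝ] ℝ) y * (β : V →L[ℝ] ℝ) x := by
        intro x
        have := h x y
        field_simp
        linarith
      have hc : (α : V →L[ℝ] ℝ) y / (β : V →L[ℝ] ℝ) y ≠ 0 := by
        intro h
        exact α.2 (ContinuousLinearMap.ext fun x => by simp [hprop x, h])
      exact ⟨Units.mk0 _ hc, ContinuousLinearMap.ext fun x => (hprop x).symm⟩
  rw [hset]
  refine isClosed_iInter fun x => isClosed_iInter fun y => isClosed_eq ?_ ?_ <;> fun_prop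

end Projectivization

variable {n : ℕ}

/-- The map `(z, ξ) ↦ (z, [ξ])`. -/
noncomputable def ofHomogeneous (q : SpaceTime n × {α : Covector n // α ≠ 0}) : PT n :=
  (q.1, Projectivization.mk' ℝ q.2)

lemma isOpenQuotientMap_ofHomogeneous : IsOpenQuotientMap (ofHomogeneous (n := n)) :=
  IsOpenQuotientMap.prodMap .id isOpenQuotientMap_mk'

/-! ### The contact lift as a local homeomorphism -/

/-- `Φ` is a smooth diffeomorphism between open sets. -/
def IsSmoothDiffeo (Φ : OpenPartialHomeomorph (SpaceTime n) (SpaceTime n)) : Prop :=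
  ContDiffOn ℝ ∞ Φ Φ.source ∧ ContDiffOn ℝ ∞ Φ.symm Φ.target

namespace IsSmoothDiffeo

variable {Φ : OpenPartialHomeomorph (SpaceTime n) (SpaceTime n)}

/-- This symmetry lets the inclusion of germs be proved once and applied to both `Φ` and `Φ.symm`.
-/
lemma symm (hΦ : IsSmoothDiffeo Φ) : IsSmoothDiffeo Φ.symm := ⟨hΦ.2, hΦ.1⟩

lemma contDiffAt (hΦ : IsSmoothDiffeo Φ) {z : SpaceTime n} (hz : z ∈ Φ.source) :
    ContDiffAt ℝ ∞ Φ z :=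
  hΦ.1.contDiffAt (Φ.open_source.mem_nhds hz)

lemma differentiableAt (hΦ : IsSmoothDiffeo Φ) {z : SpaceTime n} (hz : z ∈ Φ.source) :
    DifferentiableAt ℝ Φ z :=
  (hΦ.contDiffAt hz).differentiableAt (by simp)

lemma fderiv_symm_comp_fderiv (hΦ : IsSmoothDiffeo Φ) {z : SpaceTime n} (hz : z ∈ Φ.source) :
    (fderiv ℝ Φ.symm (Φ z)).comp (fderiv ℝ Φ z) = ContinuousLinearMap.id ℝ (SpaceTime n) := by
  rw [← fderiv_comp z (hΦ.symm.differentiableAt (Φ.map_source hz)) (hΦ.differentiableAt hz)]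
  have : (Φ.symm ∘ Φ) =ᶠ[𝓝 z] id := by
    filter_upwards [Φ.open_source.mem_nhds hz] with w hw using Φ.left_inv hw
  rw [this.fderiv_eq, fderiv_id]

lemma comp_fderiv_symm_ne_zero (hΦ : IsSmoothDiffeo Φ) {z : SpaceTime n} (hz : z ∈ Φ.source)
    {α : Covector n} (hα : α ≠ 0) : α.comp (fderiv ℝ Φ.symm (Φ z)) ≠ 0 := by
  intro h
  apply hα
  have h' := congrArg (fun β : Covector n => β.comp (fderiv ℝ Φ z)) h
  simpa [ContinuousLinearMap.comp_assoc, hΦ.fderiv_symm_comp_fderiv hz] using h'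

lemma contactLift_mk (hΦ : IsSmoothDiffeo Φ) {z : SpaceTime n} (hz : z ∈ Φ.source)
    {α : Covector n} (hα : α ≠ 0) :
    contactLift Φ (z, Projectivization.mk ℝ α hα) =
      (Φ z, Projectivization.mk ℝ (α.comp (fderiv ℝ Φ.symm (Φ z)))
        (hΦ.comp_fderiv_symm_ne_zero hz hα)) := by
  have h := hΦ.comp_fderiv_symm_ne_zero hz (Projectivization.mk ℝ α hα).rep_nonzero
  rw [contactLift, dif_pos h]
  obtain ⟨a, ha⟩ := Projectivization.exists_smul_eq_mk_rep ℝ α hα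
  refine Prod.ext rfl ((Projectivization.mk_eq_mk_iff ℝ _ _ _ _).2 ⟨a, ?_⟩)
  simp only [← ha]
  ext <;> simp

lemma contactLift_fst (hΦ : IsSmoothDiffeo Φ) {p : PT n} (hp : p.1 ∈ Φ.source) :
    (contactLift Φ p).1 = Φ p.1 := by
  obtain ⟨⟨z, α⟩, rfl⟩ := isOpenQuotientMap_ofHomogeneous.surjective p
  exact congrArg Prod.fst (hΦ.contactLift_mk hp α.2)

lemma contactLift_symm_contactLift (hΦ : IsSmoothDiffeo Φ) {p : PT n} (hp : p.1 ∈ Φ.source) :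
    contactLift Φ.symm (contactLift Φ p) = p := by
  obtain ⟨⟨z, α⟩, rfl⟩ := isOpenQuotientMap_ofHomogeneous.surjective p
  have hz : z ∈ Φ.source := hp
  change contactLift Φ.symm (contactLift Φ (z, Projectivization.mk ℝ (α : Covector n) α.2)) =
    (z, Projectivization.mk ℝ (α : Covector n) α.2)
  rw [hΦ.contactLift_mk hz, hΦ.symm.contactLift_mk (Φ.map_source hz)]
  refine Prod.ext (Φ.left_inv hz) ((Projectivization.mk_eq_mk_iff ℝ _ _ _ _).2 ⟨1, ?_⟩)
  rw [one_smul, Φ.symm_symm, ContinuousLinearMap.comp_assoc, Φ.left_inv hz,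
    hΦ.fderiv_symm_comp_fderiv hz, ContinuousLinearMap.comp_id]

lemma contactLift_contactLift_symm (hΦ : IsSmoothDiffeo Φ) {p : PT n} (hp : p.1 ∈ Φ.target) :
    contactLift Φ (contactLift Φ.symm p) = p := by
  simpa using hΦ.symm.contactLift_symm_contactLift (p := p) hp

/-- Continuity is checked in homogeneous coordinates, where the lift is `(z, α) ↦ (Φ z, α ∘
(dΦ_z)⁻¹)`, and descends through the open quotient. -/
lemma continuousAt_contactLift (hΦ : IsSmoothDiffeo Φ) {p : PT n} (hp : p.1 ∈ Φ.source) :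
    ContinuousAt (contactLift Φ) p := by
  obtain ⟨⟨z, α⟩, rfl⟩ := isOpenQuotientMap_ofHomogeneous.surjective p
  have hz : z ∈ Φ.source := hp
  rw [← isOpenQuotientMap_ofHomogeneous.continuousAt_comp_iff]
  have hcont : ContinuousAt (fun q : SpaceTime n × {α : Covector n // α ≠ 0} =>
      (q.2 : Covector n).comp (fderiv ℝ Φ.symm (Φ q.1))) (z, α) := by
    have h1 : ContinuousAt (fderiv ℝ Φ.symm) (Φ z) :=
      (hΦ.symm.contDiffAt (Φ.map_source hz)).continuousAt_fderiv (by simp)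
    have h2 : ContinuousAt (fun q : SpaceTime n × {α : Covector n // α ≠ 0} => Φ q.1) (z, α) :=
      ContinuousAt.comp (f := Prod.fst) (g := Φ) (hΦ.differentiableAt hz).continuousAt
        continuousAt_fst
    have h3 : ContinuousAt (fun q : SpaceTime n × {α : Covector n // α ≠ 0} =>
        fderiv ℝ Φ.symm (Φ q.1)) (z, α) := ContinuousAt.comp (g := fderiv ℝ Φ.symm) h1 h2
    exact (continuous_subtype_val.comp continuous_snd).continuousAt.clm_comp h3
  classical
  let g : SpaceTime n × {α : Covector n // α ≠ 0} → SpaceTime n × {α : Covector n // α ≠ 0} :=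
    fun q => (Φ q.1, if h : (q.2 : Covector n).comp (fderiv ℝ Φ.symm (Φ q.1)) ≠ 0 then
      ⟨_, h⟩ else q.2)
  have hsrc : ∀ᶠ q : SpaceTime n × {α : Covector n // α ≠ 0} in 𝓝 (z, α), q.1 ∈ Φ.source :=
    continuousAt_fst (Φ.open_source.mem_nhds hz)
  have hg : ContinuousAt g (z, α) := by
    refine ContinuousAt.prodMk (ContinuousAt.comp (f := Prod.fst) (g := Φ)
      (hΦ.differentiableAt hz).continuousAt continuousAt_fst) ?_
    refine Topology.IsInducing.subtypeVal.continuousAt_iff.2 ?_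
    refine hcont.congr ?_
    filter_upwards [hsrc] with q hq
    have := hΦ.comp_fderiv_symm_ne_zero hq q.2.2
    simp [this]
  refine (isOpenQuotientMap_ofHomogeneous.continuous.continuousAt.comp hg).congr ?_
  filter_upwards [hsrc] with q hq
  have h := hΦ.comp_fderiv_symm_ne_zero hq q.2.2
  refine Eq.trans ?_ (hΦ.contactLift_mk hq q.2.2).symm
  simp only [Function.comp_apply, g, dif_pos h]
  rfl

end IsSmoothDiffeo

lemma IsSPDiffeoGerm.isSmoothDiffeo {Φ : OpenPartialHomeomorph (SpaceTime n) (SpaceTime n)}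
    {q q' : SpaceTime n} (hΦ : IsSPDiffeoGerm Φ q q') : IsSmoothDiffeo Φ :=
  ⟨hΦ.contDiffOn, hΦ.contDiffOn_symm⟩

/-! ### Local parametrizations of submanifolds -/

namespace IsLocalParam

variable {L : Set (PT n)} {p : PT n} {O : Set (EuclideanSpace ℝ (Fin n))}
  {u₀ : EuclideanSpace ℝ (Fin n)} {γ : EuclideanSpace ℝ (Fin n) → SpaceTime n}
  {ξ : EuclideanSpace ℝ (Fin n) → {α : Covector n // α ≠ 0}}

lemma continuousOn (h : IsLocalParam L p O u₀ γ ξ) : ContinuousOn (toPT γ ξ) O :=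
  continuousOn_iff_continuous_domRestrict.2 h.embedding.continuous

lemma tendsto (h : IsLocalParam L p O u₀ γ ξ) : Tendsto (toPT γ ξ) (𝓝 u₀) (𝓝 p) := by
  have := h.continuousOn.continuousAt (h.isOpen.mem_nhds h.mem)
  rwa [ContinuousAt, h.map_eq] at this

lemma toPT_mem (h : IsLocalParam L p O u₀ γ ξ) {u : EuclideanSpace ℝ (Fin n)} (hu : u ∈ O) :
    toPT γ ξ u ∈ L := by
  obtain ⟨V, -, hV⟩ := h.image_eq
  exact (hV.subset (mem_image_of_mem _ hu)).1

/-- Points of `L` near `p` have parameters near `u₀`. -/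
lemma eventually_exists_eq (h : IsLocalParam L p O u₀ γ ξ) {W : Set (EuclideanSpace ℝ (Fin n))}
    (hW : W ∈ 𝓝 u₀) : ∀ᶠ q in 𝓝 p, q ∈ L → ∃ u ∈ O, u ∈ W ∧ toPT γ ξ u = q := by
  obtain ⟨V, hVo, hV⟩ := h.image_eq
  have hW' : (Subtype.val ⁻¹' W : Set O) ∈ 𝓝 (⟨u₀, h.mem⟩ : O) :=
    continuousAt_subtype_val hW
  rw [h.embedding.isInducing.nhds_eq_comap, mem_comap] at hW'
  obtain ⟨T, hT, hTW⟩ := hW'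
  have hT' : T ∈ 𝓝 p := by
    rw [← h.map_eq]
    exact hT
  have hp : p ∈ V := by
    rw [← h.map_eq]
    exact (hV.subset (mem_image_of_mem _ h.mem)).2
  filter_upwards [hVo.mem_nhds hp, hT'] with q hqV hqT hqL
  obtain ⟨u, hu, rfl⟩ := hV.superset ⟨hqL, hqV⟩
  exact ⟨u, hu, hTW (show (⟨u, hu⟩ : O) ∈ O.domRestrict (toPT γ ξ) ⁻¹' T from hqT), rfl⟩

/-- A submanifold is locally closed. -/
lemma exists_closure_subset (h : IsLocalParam L p O u₀ γ ξ) :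
    ∃ V ∈ 𝓝 p, closure (L ∩ V) ⊆ L := by
  obtain ⟨K, hK, hKO, hKc⟩ := local_compact_nhds (h.isOpen.mem_nhds h.mem)
  have himg : IsCompact (toPT γ ξ '' K) := hKc.image_of_continuousOn (h.continuousOn.mono hKO)
  refine ⟨_, h.eventually_exists_eq hK, ?_⟩
  -- Near `p` the set `L` lies in the image of the compact `K`, which is closed because `PT n` is
  -- Hausdorff.
  have hsub : closure (L ∩ {q | q ∈ L → ∃ u ∈ O, u ∈ K ∧ toPT γ ξ u = q}) ⊆ toPT γ ξ '' K := by
    refine closure_minimal ?_ himg.isClosed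
    rintro q ⟨hq, hq'⟩
    obtain ⟨u, -, hu, rfl⟩ := hq' hq
    exact mem_image_of_mem _ hu
  refine hsub.trans ?_
  rintro _ ⟨u, hu, rfl⟩
  exact h.toPT_mem (hKO hu)

end IsLocalParam

/-! ### From inclusion of fronts to inclusion of Legendrian germs -/

variable {Φ : OpenPartialHomeomorph (SpaceTime n) (SpaceTime n)} {L L' : Set (PT n)}

/-- If `Φ` maps the front of `L` near a regular point `p` into the front of a part of `L'` covered
by one Legendrian chart, then the contact lift of `p` is a limit of points of that part. -/
lemma contactLift_mem_closure_of_mem_regularSet (hΦ : IsSmoothDiffeo Φ) (hL : IsBigLegendrian L)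
    {p : PT n} (hp : p ∈ regularSet L) (hpΦ : p.1 ∈ Φ.source)
    {O' : Set (EuclideanSpace ℝ (Fin n))} {γ' : EuclideanSpace ℝ (Fin n) → SpaceTime n}
    {ξ' : EuclideanSpace ℝ (Fin n) → {α : Covector n // α ≠ 0}} (hO' : IsOpen O')
    (hγ' : DifferentiableOn ℝ γ' O')
    (hLeg' : ∀ u ∈ O', ∀ v, (ξ' u : Covector n) (fderiv ℝ γ' u v) = 0)
    (hcover : ∀ q ∈ L', ∃ u ∈ O', toPT γ' ξ' u = q)
    (hfront : ∀ᶠ r in 𝓝 p, r ∈ L → Φ r.1 ∈ bigWaveFront L') :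
    contactLift Φ p ∈ closure L' := by
  obtain ⟨hpL, O, u₀, γ, ξ, h, hinj⟩ := hp
  -- The chart witnessing regularity is not assumed to satisfy the contact condition, and this
  -- Legendrian chart is not known to be immersive on the base. Applying `ae_range_fderiv_eq` to the
  -- pair transfers the contact condition to the first chart for almost every parameter.
  obtain ⟨O₁, u₁, γ₁, ξ₁, h₁, hLeg₁⟩ := hL p hpL
  have hγu₀ : γ u₀ = p.1 := congrArg Prod.fst h.map_eq
  have hγc : ContDiffAt ℝ ∞ γ u₀ := h.smooth_base.contDiffAt (h.isOpen.mem_nhds h.mem)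
  have hΦγ : ContDiffAt ℝ ∞ (Φ ∘ γ) u₀ :=
    ContDiffAt.comp u₀ (hΦ.contDiffAt (by rwa [hγu₀])) hγc
  have hchain : ∀ u ∈ O, γ u ∈ Φ.source →
      fderiv ℝ (Φ ∘ γ) u = (fderiv ℝ Φ (γ u)).comp (fderiv ℝ γ u) := fun u hu hs =>
    fderiv_comp u (hΦ.differentiableAt hs)
      ((h.smooth_base.contDiffAt (h.isOpen.mem_nhds hu)).differentiableAt (by simp))
  have hinvΦ : ∀ z ∈ Φ.source, ∀ v, fderiv ℝ Φ.symm (Φ z) (fderiv ℝ Φ z v) = v := fun z hz v =>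
    congrArg (fun A : SpaceTime n →L[ℝ] SpaceTime n => A v) (hΦ.fderiv_symm_comp_fderiv hz)
  have hinj' : Function.Injective (fderiv ℝ (Φ ∘ γ) u₀) := by
    have hs : γ u₀ ∈ Φ.source := by rwa [hγu₀]
    rw [hchain u₀ h.mem hs]
    exact (Function.LeftInverse.injective (hinvΦ _ hs)).comp hinj
  obtain ⟨B, hB, hBae⟩ := ae_range_fderiv_eq volume (hγc.of_le (by simp)) hinj h₁.isOpen
    (h₁.smooth_base.differentiableOn (by simp))
  obtain ⟨B', hB', hBae'⟩ := ae_range_fderiv_eq volume (hΦγ.of_le (by simp)) hinj' hO' hγ'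
  have hdense := mem_closure_iff_frequently.1 (Measure.dense_of_ae (hBae.and hBae') u₀)
  have htend : Tendsto (fun u => contactLift Φ (toPT γ ξ u)) (𝓝 u₀) (𝓝 (contactLift Φ p)) :=
    (hΦ.continuousAt_contactLift hpΦ).tendsto.comp h.tendsto
  refine mem_closure_of_frequently_of_tendsto ?_ htend
  have hsrc : ∀ᶠ r : PT n in 𝓝 p, r.1 ∈ Φ.source :=
    continuousAt_fst (Φ.open_source.mem_nhds hpΦ)
  refine (hdense.and_eventually (((eventually_mem_set.2 (h.isOpen.mem_nhds h.mem)).and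
    ((eventually_mem_set.2 hB).and (eventually_mem_set.2 hB'))).and
    (h.tendsto.eventually (hfront.and (hsrc.and
      (h₁.eventually_exists_eq univ_mem)))))).mono ?_
  rintro u ⟨⟨hu, hu'⟩, ⟨huO, huB, huB'⟩, hfr, hus, hex⟩
  have huL := h.toPT_mem huO
  obtain ⟨w₁, hw₁, -, heq₁⟩ := hex huL
  obtain ⟨q, hq, hqΦ⟩ := hfr huL
  obtain ⟨w', hw', rfl⟩ := hcover q hq
  have hqΦ' : γ' w' = Φ (γ u) := hqΦ
  have hus' : γ u ∈ Φ.source := hus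
  have hr₁ := (hu huB).2 w₁ hw₁ (congrArg Prod.fst heq₁)
  have hr' := (hu' huB').2 w' hw' hqΦ'
  obtain ⟨c, hc⟩ := (mk'_eq_mk'_iff _ _).1 (congrArg Prod.snd heq₁).symm
  have hξ : ∀ v, (ξ u : Covector n) (fderiv ℝ γ u v) = 0 := by
    intro v
    obtain ⟨w, hw⟩ : fderiv ℝ γ u v ∈ range (fderiv ℝ γ₁ w₁) := hr₁ ▸ mem_range_self v
    rw [← hw, ← hc, _root_.smul_apply, hLeg₁ w₁ hw₁, smul_zero]
  have hξ' : ∀ v, (ξ' w' : Covector n) (fderiv ℝ (Φ ∘ γ) u v) = 0 := by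
    intro v
    obtain ⟨w, hw⟩ : fderiv ℝ (Φ ∘ γ) u v ∈ range (fderiv ℝ γ' w') := hr' ▸ mem_range_self v
    rw [← hw, hLeg' w' hw']
  have hlift := hΦ.contactLift_mk hus' (ξ u).2
  obtain ⟨c', hc'⟩ := exists_units_smul_eq_of_range_le_ker (by simp) (hu' huB').1
    (hΦ.comp_fderiv_symm_ne_zero hus' (ξ u).2) (ξ' w').2
    (fun v => by
      rw [hchain u huO hus', ContinuousLinearMap.comp_apply, ContinuousLinearMap.comp_apply,
        hinvΦ _ hus', hξ]) hξ'
  have : contactLift Φ (toPT γ ξ u) = toPT γ' ξ' w' :=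
    hlift.trans (Prod.ext hqΦ'.symm ((Projectivization.mk_eq_mk_iff ℝ _ _ _ _).2 ⟨c', hc'⟩))
  rw [this]
  exact hq

/-- If `Φ` maps arbitrarily small fronts of `(L, p₀)` into fronts of `(L', p₀')`, then the contact
lifts of the points of `L` near `p₀` are limits of points of `L'` near `p₀'`. -/
lemma eventually_contactLift_mem_closure (hΦ : IsSmoothDiffeo Φ) (hL : IsBigLegendrian L)
    (hL' : IsBigLegendrian L') {p₀ p₀' : PT n} (hp₀' : p₀' ∈ L') (hreg : RegularDenseAt L p₀)
    (hsrc : p₀.1 ∈ Φ.source) (hΦp₀ : Φ p₀.1 = p₀'.1)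
    (hfront : ∀ V' ∈ 𝓝 p₀', ∃ U ∈ 𝓝 p₀, ∀ᶠ z in 𝓝 p₀'.1,
      z ∈ Φ '' (bigWaveFront (L ∩ U) ∩ Φ.source) → z ∈ bigWaveFront (L' ∩ V'))
    {V' : Set (PT n)} (hV' : V' ∈ 𝓝 p₀') :
    ∀ᶠ p in 𝓝 p₀, p ∈ L → contactLift Φ p ∈ closure (L' ∩ V') := by
  obtain ⟨O', u', γ', ξ', h', hLeg'⟩ := hL' p₀' hp₀'
  obtain ⟨R, hR, hRL⟩ := hreg
  -- Restricting to `C` ensures that every point of `L'` supplied by the front inclusion lies in the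
  -- one Legendrian chart.
  set C : Set (PT n) := {q | q ∈ L' → ∃ u ∈ O', u ∈ univ ∧ toPT γ' ξ' u = q} with hC
  have hC' : C ∈ 𝓝 p₀' := h'.eventually_exists_eq univ_mem
  obtain ⟨U, hU, hUfront⟩ := hfront _ (inter_mem hV' hC')
  have hfst : Tendsto (fun p : PT n => Φ p.1) (𝓝 p₀) (𝓝 p₀'.1) := by
    rw [← hΦp₀]
    exact (hΦ.differentiableAt hsrc).continuousAt.tendsto.comp continuousAt_fst
  have hsrc' : ∀ᶠ r : PT n in 𝓝 p₀, r.1 ∈ Φ.source :=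
    continuousAt_fst (Φ.open_source.mem_nhds hsrc)
  obtain ⟨N, hN, hNo, hpN⟩ := eventually_nhds_iff.1 ((hfst.eventually hUfront).and
    (hsrc'.and ((eventually_mem_set.2 hR).and (eventually_mem_set.2 hU))))
  filter_upwards [hNo.mem_nhds hpN] with p hp hpL
  have hreg' : ∀ r ∈ N ∩ regularSet L, contactLift Φ r ∈ closure (L' ∩ V') := by
    rintro r ⟨hrN, hr⟩
    refine closure_mono (inter_subset_inter_right L' inter_subset_left)
      (contactLift_mem_closure_of_mem_regularSet hΦ hL hr (hN r hrN).2.1 h'.isOpen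
      (h'.smooth_base.differentiableOn (by simp)) hLeg' (L' := L' ∩ (V' ∩ C)) ?_ ?_)
    · rintro q ⟨hqL, -, hqC⟩
      obtain ⟨u, hu, -, huq⟩ := hqC hqL
      exact ⟨u, hu, huq⟩
    · filter_upwards [hNo.mem_nhds hrN] with s hs hsL
      obtain ⟨hs₁, hs₂, -, hs₃⟩ := hN s hs
      exact hs₁ ⟨s.1, ⟨⟨s, ⟨hsL, hs₃⟩, rfl⟩, hs₂⟩, rfl⟩
  have hpcl : p ∈ closure (N ∩ regularSet L) :=
    hNo.inter_closure ⟨hp, hRL ⟨hpL, (hN p hp).2.2.1⟩⟩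
  rw [← closure_closure]
  exact (hΦ.continuousAt_contactLift (hN p hp).2.1).continuousWithinAt.mem_closure hpcl hreg'

/-- If `Φ` maps arbitrarily small fronts of `(L, p₀)` into fronts of `(L', p₀')`, then its contact
lift maps the germ `(L, p₀)` into the germ `(L', p₀')`. -/
lemma contactLift_eq_and_eventually_mem (hΦ : IsSmoothDiffeo Φ) (hL : IsBigLegendrian L)
    (hL' : IsBigLegendrian L') {p₀ p₀' : PT n} (hp₀ : p₀ ∈ L) (hp₀' : p₀' ∈ L')
    (hreg : RegularDenseAt L p₀) (hsrc : p₀.1 ∈ Φ.source) (hΦp₀ : Φ p₀.1 = p₀'.1)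
    (hfront : ∀ V' ∈ 𝓝 p₀', ∃ U ∈ 𝓝 p₀, ∀ᶠ z in 𝓝 p₀'.1,
      z ∈ Φ '' (bigWaveFront (L ∩ U) ∩ Φ.source) → z ∈ bigWaveFront (L' ∩ V')) :
    contactLift Φ p₀ = p₀' ∧ ∀ᶠ p in 𝓝 p₀, p ∈ L → contactLift Φ p ∈ L' := by
  have key : ∀ V' ∈ 𝓝 p₀', ∀ᶠ p in 𝓝 p₀, p ∈ L → contactLift Φ p ∈ closure (L' ∩ V') :=
    fun V' hV' => eventually_contactLift_mem_closure hΦ hL hL' hp₀' hreg hsrc hΦp₀ hfront hV'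
  constructor
  -- The lift of `p₀` lies in the closure of every neighbourhood of `p₀'`.
  · by_contra hne
    obtain ⟨S, T, hS, hT, hpS, hpT, hST⟩ := t2_separation hne
    obtain ⟨q, hqS, -, hqT⟩ := mem_closure_iff.1
      ((key T (hT.mem_nhds hpT)).self_of_nhds hp₀) S hS hpS
    exact hST.notMem_of_mem_left hqS hqT
  · obtain ⟨O', u', γ', ξ', h', -⟩ := hL' p₀' hp₀'
    obtain ⟨V', hV', hcl⟩ := h'.exists_closure_subset
    exact (key V' hV').mono fun p hp hpL => hcl (hp hpL)

/-! ### The two implications -/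

/-- The contact lift of an equivalence of germs maps small fronts onto small fronts. -/
lemma SPLegendrianEquivalent.frontsSPDiffeomorphic {p₀ p₀' : PT n}
    (h : SPLegendrianEquivalent L p₀ L' p₀') : FrontsSPDiffeomorphic L p₀ L' p₀' := by
  obtain ⟨Φ, hΦ, hp, hgerm⟩ := h
  have hs := hΦ.isSmoothDiffeo
  have htgt : p₀'.1 ∈ Φ.target := hΦ.map_eq ▸ Φ.map_source hΦ.mem_source
  have hinv : contactLift Φ.symm p₀' = p₀ := by
    rw [← hp, hs.contactLift_symm_contactLift hΦ.mem_source]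
  refine ⟨Φ, hΦ, fun V hV V' hV' => ?_⟩
  have hcont : Tendsto (contactLift Φ) (𝓝 p₀) (𝓝 p₀') := by
    have := hs.continuousAt_contactLift hΦ.mem_source
    rwa [ContinuousAt, hp] at this
  have hcont' : Tendsto (contactLift Φ.symm) (𝓝 p₀') (𝓝 p₀) := by
    have := hs.symm.continuousAt_contactLift htgt
    rwa [ContinuousAt, hinv] at this
  -- On `U'` the germ equality is an actual equality and the inverse lift lands in `V`. The lift
  -- then carries the part of `L ∩ U` over `Φ.source` exactly onto `L' ∩ U'`, so the fronts agree
  -- everywhere.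
  set U' : Set (PT n) := V' ∩ ({r | r ∈ contactLift Φ '' (L ∩ {p | p.1 ∈ Φ.source}) ↔ r ∈ L'} ∩
    contactLift Φ.symm ⁻¹' V) with hU'
  have hU'n : U' ∈ 𝓝 p₀' := inter_mem hV' (inter_mem hgerm (hcont' hV))
  refine ⟨V ∩ contactLift Φ ⁻¹' U', inter_mem hV (hcont hU'n), U', hU'n, inter_subset_left,
    inter_subset_left, Eventually.of_forall fun z => ⟨?_, ?_⟩⟩
  · rintro ⟨_, ⟨⟨p, ⟨hpL, -, hpU'⟩, rfl⟩, hpΦ⟩, rfl⟩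
    exact ⟨contactLift Φ p, ⟨hpU'.2.1.1 ⟨p, ⟨hpL, hpΦ⟩, rfl⟩, hpU'⟩, hs.contactLift_fst hpΦ⟩
  · rintro ⟨q, ⟨hqL', hqU'⟩, rfl⟩
    obtain ⟨p, ⟨hpL, hpΦ⟩, rfl⟩ := hqU'.2.1.2 hqL'
    have hpV : p ∈ V := by
      have := hqU'.2.2
      rwa [mem_preimage, hs.contactLift_symm_contactLift hpΦ] at this
    exact ⟨p.1, ⟨⟨p, ⟨hpL, hpV, hqU'⟩, rfl⟩, hpΦ⟩, (hs.contactLift_fst hpΦ).symm⟩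

/-- A diffeomorphism of the front germs lifts to an equivalence of the Legendrian germs. -/
lemma FrontsSPDiffeomorphic.spLegendrianEquivalent {p₀ p₀' : PT n} (hL : IsBigLegendrian L)
    (hL' : IsBigLegendrian L') (hp₀ : p₀ ∈ L) (hp₀' : p₀' ∈ L') (hreg : RegularDenseAt L p₀)
    (hreg' : RegularDenseAt L' p₀') (h : FrontsSPDiffeomorphic L p₀ L' p₀') :
    SPLegendrianEquivalent L p₀ L' p₀' := by
  obtain ⟨Φ, hΦ, hfront⟩ := h
  have hs := hΦ.isSmoothDiffeo
  have htgt : p₀'.1 ∈ Φ.target := hΦ.map_eq ▸ Φ.map_source hΦ.mem_source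
  have hsymm : Φ.symm p₀'.1 = p₀.1 := by rw [← hΦ.map_eq, Φ.left_inv hΦ.mem_source]
  have hmono : ∀ {M S T : Set (PT n)} {z : SpaceTime n}, S ⊆ T →
      z ∈ bigWaveFront (M ∩ S) → z ∈ bigWaveFront (M ∩ T) := fun hST hz =>
    image_mono (inter_subset_inter_right _ hST) hz
  obtain ⟨heq, hmem⟩ := contactLift_eq_and_eventually_mem hs hL hL' hp₀ hp₀' hreg hΦ.mem_source
    hΦ.map_eq fun V' hV' => by
      obtain ⟨U, hU, U', -, -, hU'V', hg⟩ := hfront univ univ_mem V' hV'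
      exact ⟨U, hU, hg.mono fun z hz hzU => hmono hU'V' (hz.1 hzU)⟩
  obtain ⟨-, hmem'⟩ := contactLift_eq_and_eventually_mem hs.symm hL' hL hp₀' hp₀ hreg' htgt
    hsymm fun V hV => by
      obtain ⟨U, -, U', hU', hUV, -, hg⟩ := hfront V hV univ univ_mem
      have hΦcont : Tendsto Φ (𝓝 p₀.1) (𝓝 p₀'.1) := by
        have := (hs.differentiableAt hΦ.mem_source).continuousAt
        rwa [ContinuousAt, hΦ.map_eq] at this
      refine ⟨U', hU', ?_⟩
      -- The equality of front germs at `π(p₀')` is pulled back along `Φ` to `π(p₀)`.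
      filter_upwards [hΦcont.eventually hg] with z hz
      rintro ⟨w, ⟨hw, hwt⟩, rfl⟩
      rw [Φ.right_inv hwt] at hz
      obtain ⟨y, ⟨hy, hys⟩, rfl⟩ := hz.2 hw
      rw [Φ.left_inv hys]
      exact hmono hUV hy
  have hcont' : Tendsto (contactLift Φ.symm) (𝓝 p₀') (𝓝 p₀) := by
    have := hs.symm.continuousAt_contactLift htgt
    rwa [ContinuousAt, ← heq, hs.contactLift_symm_contactLift hΦ.mem_source, heq] at this
  refine ⟨Φ, hΦ, heq, ?_⟩
  have htgt' : ∀ᶠ r : PT n in 𝓝 p₀', r.1 ∈ Φ.target :=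
    continuousAt_fst (Φ.open_target.mem_nhds htgt)
  -- A point `p` over `Φ.source` whose lift is `q` must be the inverse lift of `q`, hence is near
  -- `p₀` when `q` is near `p₀'`; so `hmem` applies to it.
  filter_upwards [hmem', hcont'.eventually hmem, htgt'] with q hq₁ hq₂ hqt
  constructor
  · rintro ⟨p, ⟨hpL, hpΦ⟩, rfl⟩
    rw [hs.contactLift_symm_contactLift hpΦ] at hq₂
    exact hq₂ hpL
  · intro hqL'
    refine ⟨contactLift Φ.symm q, ⟨hq₁ hqL', ?_⟩, hs.contactLift_contactLift_symm hqt⟩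
    rw [mem_ofPred_eq, hs.symm.contactLift_fst hqt]
    exact Φ.map_target hqt

end BigFront

theorem proposition6p4 (n : ℕ) (L L' : Set (BigFront.PT n)) (p₀ p₀' : BigFront.PT n)
    (hL : BigFront.IsBigLegendrian L) (hL' : BigFront.IsBigLegendrian L')
    (hp₀ : p₀ ∈ L) (hp₀' : p₀' ∈ L')
    (hreg : BigFront.RegularDenseAt L p₀) (hreg' : BigFront.RegularDenseAt L' p₀') :
    BigFront.SPLegendrianEquivalent L p₀ L' p₀' ↔
      BigFront.FrontsSPDiffeomorphic L p₀ L' p₀' :=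
  ⟨fun h => h.frontsSPDiffeomorphic, fun h => h.spLegendrianEquivalent hL hL' hp₀ hp₀' hreg hreg'⟩
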